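/- **Setting.** Let $G$ be a locally finite tree (a connected graph without cycles in which every vertex has finitely many neighbours) with a distinguished vertex $o^*$ (the pre-root) that has exactly one neighbour $o$ (the root). Let $E$ be its set of edges and $T$ the set of its vertices other than $o^*$. Let $\overline T$ be the union of $T$ and the set of infinite geodesics starting at $o^*$ (a finite maximal geodesic is identified with the leaf at which it ends). For $x\in\overline T$ let $[o^*,x]\subseteq E$ be the set of edges of the geodesic from $o^*$ to $x$. For $\alpha\in E$ let $e(\alpha)$ be its endpoint furthest from $o^*$ and $S(\alpha)=\{x\in\overline T:\alpha\in[o^*,x]\}$; write $\beta\subseteq\alpha$ if $\alpha\in[o^*,e(\beta)]$. The set $\overline T$ carries the topology generated by the sets $S(\alpha)$, $\alpha\in E$, and the singletons $\{x\}$, $x\in T$. Let $1<p<\infty$, $p^*=p/(p-1)$, let $\pi:E\to[0,\infty)$, and let $\mu$ be a finite positive Borel measure on $\overline T$. For $\varphi:E\to[0,\infty)$ and $x\in\overline T$ put $$\mathcal I\varphi(x)=\sum_{\alpha\in[o^*,x]}\varphi(\alpha)\in[0,\infty],$$ and for $A\subseteq\overline T$ put $$\mathrm{Cap}_{p,\pi}(A)=\inf\Big\{\sum_{\alpha\in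 E}\varphi(\alpha)^p\pi(\alpha)\;:\;\varphi:E\to[0,\infty),\ \mathcal I\varphi\ge 1\text{ on }A\Big\}.$$ All quantities below take values in $[0,\infty]$, with $0^{-1}=\infty$, $0^{1-p^*}=\infty$ and $\infty\cdot 0=0$. **Theorem 1.2.** Let $[\mu]$ be the smallest constant in $[0,\infty]$ such that $$\int_{\overline T}(\mathcal I\varphi)^p\,d\mu\le[\mu]\sum_{\alpha\in E}\varphi(\alpha)^p\pi(\alpha)\qquad\text{for all }\varphi:E\to[0,\infty),\tag{H}$$ with $[\mu]=\infty$ if there is no finite one. Define $[[\mu]]$ and $[[\mu]]_c$ by $$[[\mu]]^{p^*-1}=\sup_{\alpha\in E}\ \mu(S(\alpha))^{-1}\sum_{\beta\subseteq\alpha}\pi(\beta)^{1-p^*}\mu(S(\beta))^{p^*},\qquad [[\mu]]_c=\sup\ \mathrm{Cap}_{p,\pi}\Big(\bigcup_{i=1}^nS(\alpha_i)\Big)^{-1}\sum_{i=1}^n\mu(S(\alpha_i)),$$ where the second supremum is over all finite families $\alpha_1,\dots,\alpha_n\in E$ for which the sets $S(\alpha_i)$ are pairwise disjoint. Then the following are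 equivalent: (i) the two-weight Hardy inequality (H) holds with best constant $[\mu]<\infty$; (ii) the mass–energy condition (ME): $[[\mu]]^{p^*-1}<\infty$; (iii) the isocapacitary condition (ISO): $[[\mu]]_c<\infty$. Furthermore, $$[[\mu]]_c\le[\mu]\le 2^p\,[[\mu]]_c,\qquad [[\mu]]\le[\mu]\le p^{p}\,[[\mu]].$$ -/

import Mathlib

open scoped ENNReal NNReal

namespace TreeHardy

variable {V : Type*} (G : SimpleGraph V) (r : V)

/-- The set of edges on the geodesic of a tree `G` from the pre-root `r` to the vertex `v`
(in a tree there is exactly one path from `r` to `v`). -/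
def geodesicEdges (v : V) : Set G.edgeSet :=
  {α | ∃ w : G.Walk r v, w.IsPath ∧ (α : Sym2 V) ∈ w.edges}

/-- An infinite geodesic emanating from the pre-root `r`: in a tree, a sequence of consecutively
adjacent vertices starting at `r` without repetitions. -/
structure Ray where
  /-- The sequence of vertices. -/
  toFun : ℕ → V
  start : toFun 0 = r
  adj : ∀ n, G.Adj (toFun n) (toFun (n + 1))
  injective : Function.Injective toFun

/-- The set of edges travelled by an infinite geodesic. -/
def Ray.edges {G : SimpleGraph V} {r : V} (ξ : Ray G r) : Set G.edgeSet :=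
  {α | ∃ n, (α : Sym2 V) = s(ξ.toFun n, ξ.toFun (n + 1))}

/-- The closed tree: all vertices except the pre-root `r`, together with the boundary points.
The boundary points that are added are the infinite geodesics from `r`; a maximal geodesic that is
finite is identified with the leaf at which it ends, which is a vertex already. -/
inductive ClosedTree where
  | vertex (v : V) (hv : v ≠ r) : ClosedTree
  | boundary (ξ : Ray G r) : ClosedTree

variable {G r}

/-- The set `[r, x]` of edges on the geodesic from the pre-root `r` to a point of the closed
tree. -/
def ClosedTree.edgesTo : ClosedTree G r → Set G.edgeSet
  | .vertex v _ => geodesicEdges G r v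
  | .boundary ξ => ξ.edges

variable (r) in
/-- The successor set `S(α) = {x | α ∈ [r, x]}` of an edge, a subset of the closed tree. -/
def successorSet (α : G.edgeSet) : Set (ClosedTree G r) :=
  {x | α ∈ x.edgesTo}

/-- The topology generated by the successor sets and the singletons of vertices. -/
instance : TopologicalSpace (ClosedTree G r) :=
  TopologicalSpace.generateFrom
    ({A | ∃ α : G.edgeSet, A = successorSet r α} ∪
      {A | ∃ (v : V) (hv : v ≠ r), A = {ClosedTree.vertex v hv}})

instance : MeasurableSpace (ClosedTree G r) := borel _

instance : BorelSpace (ClosedTree G r) := ⟨rfl⟩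

variable (r) in
/-- `v = e(α)`: of the two endpoints of the edge `α`, `v` is the one furthest from `r`. -/
def IsFarEnd (α : G.edgeSet) (v : V) : Prop :=
  v ∈ (α : Sym2 V) ∧ ∀ u ∈ (α : Sym2 V), G.dist r u ≤ G.dist r v

variable (r) in
/-- The edges `β ⊆ α`, that is, those with `α ∈ [r, e(β)]`. -/
def edgesBelow (α : G.edgeSet) : Set G.edgeSet :=
  {β | ∃ v, IsFarEnd r β v ∧ α ∈ geodesicEdges G r v}

/-- The Hardy operator `Iφ(x) = ∑_{α ∈ [r, x]} φ(α)`, with values in `[0, ∞]`. -/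
noncomputable def hardyOp (φ : G.edgeSet → ℝ≥0) (x : ClosedTree G r) : ℝ≥0∞ :=
  ∑' α : x.edgesTo, (φ α : ℝ≥0∞)

/-- `‖φ‖_{ℓ^p(π)}^p = ∑_α φ(α)^p π(α)`. -/
noncomputable def edgeEnergy (p : ℝ) (π φ : G.edgeSet → ℝ≥0) : ℝ≥0∞ :=
  ∑' α, (φ α : ℝ≥0∞) ^ p * (π α : ℝ≥0∞)

/-- The two-weight Hardy inequality with constant `C`. -/
def HardyInequality (p : ℝ) (π : G.edgeSet → ℝ≥0)
    (μ : MeasureTheory.Measure (ClosedTree G r)) (C : ℝ≥0∞) : Prop :=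
  ∀ φ : G.edgeSet → ℝ≥0, ∫⁻ x, hardyOp φ x ^ p ∂μ ≤ C * edgeEnergy p π φ

/-- The best constant `[μ]` in the Hardy inequality (infinite if the inequality fails for every
finite constant). -/
noncomputable def traceNorm (p : ℝ) (π : G.edgeSet → ℝ≥0)
    (μ : MeasureTheory.Measure (ClosedTree G r)) : ℝ≥0∞ :=
  sInf {C | HardyInequality p π μ C}

/-- The supremum over all edges `α` of
`μ(S(α))⁻¹ ∑_{β ⊆ α} π(β)^{1 - p*} μ(S(β))^{p*}`, where `p* = p / (p - 1)`.
The arithmetic is that of `[0, ∞]`: `0⁻¹ = 0 ^ (1 - p*) = ∞` and `∞ * 0 = 0`. -/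
noncomputable def massEnergyRatio (p : ℝ) (π : G.edgeSet → ℝ≥0)
    (μ : MeasureTheory.Measure (ClosedTree G r)) : ℝ≥0∞ :=
  ⨆ α : G.edgeSet, (μ (successorSet r α))⁻¹ *
    ∑' β : edgesBelow r α,
      (π β : ℝ≥0∞) ^ (1 - p.conjExponent) * μ (successorSet r (β : G.edgeSet)) ^ p.conjExponent

/-- The constant `[[μ]]`, given by `[[μ]]^{p* - 1} = massEnergyRatio p π μ`. -/
noncomputable def massEnergyConst (p : ℝ) (π : G.edgeSet → ℝ≥0)
    (μ : MeasureTheory.Measure (ClosedTree G r)) : ℝ≥0∞ :=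
  massEnergyRatio p π μ ^ (1 / (p.conjExponent - 1))

/-- The capacity `Cap_{p,π}(A)`: the infimum of `‖φ‖_{ℓ^p(π)}^p` over `φ ≥ 0` with `Iφ ≥ 1`
on `A`. -/
noncomputable def capacity (p : ℝ) (π : G.edgeSet → ℝ≥0) (A : Set (ClosedTree G r)) : ℝ≥0∞ :=
  sInf {c | ∃ φ : G.edgeSet → ℝ≥0, (∀ x ∈ A, 1 ≤ hardyOp φ x) ∧ c = edgeEnergy p π φ}

/-- The constant `[[μ]]_c`: the supremum of `Cap_{p,π}(⋃ S(α_i))⁻¹ ∑ μ(S(α_i))` over all finite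
families of edges with pairwise disjoint successor sets. -/
noncomputable def isocapacitaryConst (p : ℝ) (π : G.edgeSet → ℝ≥0)
    (μ : MeasureTheory.Measure (ClosedTree G r)) : ℝ≥0∞ :=
  ⨆ (n : ℕ) (α : Fin n → G.edgeSet)
    (_ : Pairwise fun i j => Disjoint (successorSet r (α i)) (successorSet r (α j))),
    (capacity p π (⋃ i, successorSet r (α i)))⁻¹ * ∑ i, μ (successorSet r (α i))

end TreeHardy

namespace TreeHardy

/-! ### Tree combinatorics: successor sets form a laminar family. -/

section Graph

open SimpleGraph

variable {V : Type*} {G : SimpleGraph V} {r : V}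

/-! The successor sets of a tree are laminar: two that meet are nested (`successorSet_nested`), and
distinct edges have distinct sets (`successorSet_injective`). Let u(α) be the sum of φ over the
edges up to and including α, and u(x) = Iφ(x). Then f(u(x)) - f(0) is the sum, over the edges
leading to x, of the increments of f across each edge. Since there are countably many edges,
monotone convergence reduces (H) to finitely supported φ, and the two hard bounds use only
laminarity and this telescoping.

Isocapacity implies Hardy (`lintegral_le_of_isocapacitary`): {u ≥ t} is covered by the disjoint sets
S(α) of the edges on which u first reaches t, and the increments of min(u,t)²/t² form a test
function for the capacity of their union. Its energy is integrated against p t^(p-1) dt, edge by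
edge. Without the square each edge would contribute a divergent tail ∫ dt/t; with it the total is at
most 2^p times the energy of φ (`lintegral_sq_truncation_le`).

Mass-energy implies Hardy (`lintegral_le_of_massEnergy`): X = ∫ u^p dμ equals ∑ Δ(α) μ(S(α)), where
Δ(α), the increment of s^p across α, is at most p φ(α) u(α)^(p-1). Hölder leaves the factor ∑ u(α)^p
π(α)^(1-p*) μ(S(α))^(p*). Expanding u(α)^p into increments and exchanging sums bounds this by M X,
and the resulting inequality is solved for the finite number X.

The converse bounds test (H): on capacity test functions, and on π^(1-p*) μ(S)^(p*-1) restricted to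
edges below α. The equivalences follow from the four inequalities between constants. -/

theorem path_unique (hG : G.IsTree) {u v : V} {p q : G.Walk u v} (hp : p.IsPath)
    (hq : q.IsPath) : p = q :=
  (hG.existsUnique_path u v).unique hp hq

theorem mem_geodesicEdges_iff (hG : G.IsTree) {v : V} {p : G.Walk r v} (hp : p.IsPath)
    {α : G.edgeSet} : α ∈ geodesicEdges G r v ↔ (α : Sym2 V) ∈ p.edges := by
  constructor
  · rintro ⟨q, hq, h⟩
    rwa [path_unique hG hp hq]
  · exact fun h => ⟨p, hp, h⟩

theorem length_eq_dist_of_isPath (hG : G.IsTree) {u v : V} {p : G.Walk u v} (hp : p.IsPath) :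
    p.length = G.dist u v := by
  obtain ⟨q, hq, hl⟩ := hG.connected.exists_path_of_dist u v
  rw [path_unique hG hp hq, hl]

theorem geodesicEdges_self (hG : G.IsTree) : geodesicEdges G r r = ∅ := by
  ext α
  simp [mem_geodesicEdges_iff hG (Walk.IsPath.nil (u := r))]

/-- Every edge is the last edge of a path from the pre-root to its far end. -/
theorem exists_path_to_farEnd (hG : G.IsTree) (α : G.edgeSet) :
    ∃ (a b : V) (h : G.Adj a b) (p : G.Walk r a), (p.concat h).IsPath ∧ (α : Sym2 V) = s(a, b) ∧
      ∀ v, IsFarEnd r α v ↔ v = b := by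
  classical
  have key : ∀ (a b : V) (h : G.Adj a b) (p : G.Walk r a), p.IsPath → b ∉ p.support →
      (α : Sym2 V) = s(a, b) → ∃ (a b : V) (h : G.Adj a b) (p : G.Walk r a),
        (p.concat h).IsPath ∧ (α : Sym2 V) = s(a, b) ∧ ∀ v, IsFarEnd r α v ↔ v = b := by
    intro a b h p hp hb hα
    have hc := (Walk.concat_isPath_iff h).2 ⟨hp, hb⟩
    refine ⟨a, b, h, p, hc, hα, fun v => ?_⟩
    have h1 := length_eq_dist_of_isPath hG hp
    have h2 := length_eq_dist_of_isPath hG hc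
    rw [Walk.length_concat] at h2
    simp only [IsFarEnd, hα, Sym2.mem_iff, forall_eq_or_imp, forall_eq]
    constructor
    · rintro ⟨rfl | rfl, h3, h4⟩
      · omega
      · rfl
    · rintro rfl
      exact ⟨Or.inr rfl, by omega, le_rfl⟩
  obtain ⟨e, he⟩ := α
  induction e using Sym2.ind with
  | _ a b =>
    have h : G.Adj a b := he
    obtain ⟨p, hp⟩ := (hG.existsUnique_path r a).exists
    by_cases hb : b ∈ p.support
    · refine key b a h.symm (p.takeUntil b hb) (hp.takeUntil hb) (fun ha => ?_) Sym2.eq_swap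
      have h1 := Walk.length_takeUntil_lt_length hb h.ne.symm
      have h2 := Walk.length_takeUntil_le_length _ ha
      rw [path_unique hG ((hp.takeUntil hb).takeUntil ha) hp] at h2
      omega
    · exact key a b h p hp hb rfl

theorem geodesicEdges_subset_of_mem_support (hG : G.IsTree) {v w : V} {p : G.Walk r w}
    (hp : p.IsPath) (hv : v ∈ p.support) : geodesicEdges G r v ⊆ geodesicEdges G r w := by
  classical
  intro α hα
  rw [mem_geodesicEdges_iff hG (hp.takeUntil hv)] at hα
  exact ⟨p, hp, Walk.edges_takeUntil_subset_edges p hv hα⟩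

theorem geodesicEdges_subset_of_mem (hG : G.IsTree) {v w : V} {β : G.edgeSet}
    (hβ : β ∈ geodesicEdges G r w) (hv : v ∈ (β : Sym2 V)) :
    geodesicEdges G r v ⊆ geodesicEdges G r w := by
  obtain ⟨p, hp, h⟩ := hβ
  exact geodesicEdges_subset_of_mem_support hG hp (Walk.mem_support_of_mem_edges h hv)

theorem mem_geodesicEdges_farEnd (hG : G.IsTree) {α : G.edgeSet} {v : V} (hv : IsFarEnd r α v) :
    α ∈ geodesicEdges G r v := by
  obtain ⟨a, b, h, p, hp, hα, hb⟩ := exists_path_to_farEnd (r := r) hG α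
  obtain rfl := (hb v).1 hv
  exact ⟨_, hp, by simp [hα, Walk.edges_concat]⟩

theorem farEnd_ne (hG : G.IsTree) {α : G.edgeSet} {v : V} (hv : IsFarEnd r α v) : v ≠ r := by
  rintro rfl
  simpa [geodesicEdges_self hG] using mem_geodesicEdges_farEnd hG hv

theorem exists_farEnd (hG : G.IsTree) (α : G.edgeSet) : ∃ v, IsFarEnd r α v := by
  obtain ⟨a, b, h, p, hp, hα, hb⟩ := exists_path_to_farEnd (r := r) hG α
  exact ⟨b, (hb b).2 rfl⟩

/-- Induction that strips the last edge of the path: if one of the two edges is the last, its far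
end is the end of the path, whose geodesic contains the other edge. This is the source of
nestedness. -/
theorem mem_edges_farEnd_or (hG : G.IsTree) {v : V} (p : G.Walk r v) (hp : p.IsPath)
    {α β : G.edgeSet} (hα : (α : Sym2 V) ∈ p.edges) (hβ : (β : Sym2 V) ∈ p.edges)
    {a b : V} (ha : IsFarEnd r α a) (hb : IsFarEnd r β b) :
    α ∈ geodesicEdges G r b ∨ β ∈ geodesicEdges G r a := by
  induction p using Walk.concatRec with
  | Hnil => simp at hα
  | @Hconcat r u w p h ih =>
    have last : ∀ {γ : G.edgeSet} {c : V}, (γ : Sym2 V) = s(u, w) → IsFarEnd r γ c → c = w := by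
      intro γ c hγ hc
      have h1 := length_eq_dist_of_isPath hG ((Walk.concat_isPath_iff h).1 hp).1
      have h2 := length_eq_dist_of_isPath hG hp
      rw [Walk.length_concat] at h2
      obtain ⟨hc1, hc2⟩ := hc
      rw [hγ, Sym2.mem_iff] at hc1
      rcases hc1 with rfl | rfl
      · have := hc2 w (by simp [hγ])
        omega
      · rfl
    have hα' := hα
    have hβ' := hβ
    simp only [Walk.edges_concat, List.concat_eq_append, List.mem_append,
      List.mem_singleton] at hα' hβ'
    rcases hα' with hα' | hα'
    · rcases hβ' with hβ' | hβ'
      · exact ih ((Walk.concat_isPath_iff h).1 hp).1 hα' hβ' ha hb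
      · obtain rfl := last hβ' hb
        exact Or.inl ⟨_, hp, hα⟩
    · obtain rfl := last hα' ha
      exact Or.inr ⟨_, hp, hβ⟩

/-- The initial segment of an infinite geodesic is a path. -/
theorem Ray.exists_path (ξ : Ray G r) (n : ℕ) : ∃ p : G.Walk r (ξ.toFun n), p.IsPath ∧
    (∀ v, v ∈ p.support ↔ ∃ k ≤ n, v = ξ.toFun k) ∧
    ∀ e, e ∈ p.edges ↔ ∃ k < n, e = s(ξ.toFun k, ξ.toFun (k + 1)) := by
  induction n with
  | zero =>
    refine ⟨Walk.nil.copy rfl ξ.start.symm, by simp, fun v => ?_, by simp⟩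
    simp [ξ.start]
  | succ n ih =>
    obtain ⟨p, hp, hs, he⟩ := ih
    refine ⟨p.concat (ξ.adj n), (Walk.concat_isPath_iff _).2 ⟨hp, ?_⟩, fun v => ?_, fun e => ?_⟩
    · rw [hs]
      rintro ⟨k, hk, h⟩
      have := ξ.injective h
      omega
    · simp only [Walk.support_concat, List.mem_append, hs,
        List.mem_singleton, Nat.le_succ_iff]
      aesop
    · simp only [Walk.edges_concat, List.concat_eq_append, List.mem_append, he,
        List.mem_singleton, Nat.lt_succ_iff_lt_or_eq]
      aesop

theorem Ray.geodesicEdges (hG : G.IsTree) (ξ : Ray G r) (n : ℕ) (α : G.edgeSet) :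
    α ∈ geodesicEdges G r (ξ.toFun n) ↔
      ∃ k < n, (α : Sym2 V) = s(ξ.toFun k, ξ.toFun (k + 1)) := by
  obtain ⟨p, hp, -, he⟩ := ξ.exists_path n
  rw [mem_geodesicEdges_iff hG hp, he]

/-- Two edges on the way to a point of the closed tree are on the way to some vertex that lies on
the geodesic to this point. -/
theorem ClosedTree.exists_vertex (hG : G.IsTree) (x : ClosedTree G r) {α β : G.edgeSet}
    (hα : α ∈ x.edgesTo) (hβ : β ∈ x.edgesTo) : ∃ v, α ∈ geodesicEdges G r v ∧
      β ∈ geodesicEdges G r v ∧ geodesicEdges G r v ⊆ x.edgesTo := by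
  cases x with
  | vertex v hv => exact ⟨v, hα, hβ, subset_rfl⟩
  | boundary ξ =>
    obtain ⟨k, hk⟩ := hα
    obtain ⟨l, hl⟩ := hβ
    -- The index exceeds both k and l, so this vertex lies beyond both edges.
    refine ⟨ξ.toFun (k + l + 1), ?_, ?_, fun γ hγ => ?_⟩
    · exact (ξ.geodesicEdges hG _ _).2 ⟨k, by omega, hk⟩
    · exact (ξ.geodesicEdges hG _ _).2 ⟨l, by omega, hl⟩
    · obtain ⟨m, -, h⟩ := (ξ.geodesicEdges hG _ _).1 hγ
      exact ⟨m, h⟩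

theorem geodesicEdges_farEnd_subset (hG : G.IsTree) {x : ClosedTree G r} {β : G.edgeSet}
    (hβ : x ∈ successorSet r β) {v : V} (hv : IsFarEnd r β v) :
    geodesicEdges G r v ⊆ x.edgesTo := by
  obtain ⟨w, hw, -, h⟩ := x.exists_vertex hG hβ hβ
  exact (geodesicEdges_subset_of_mem hG hw hv.1).trans h

/-- The far end of β belongs to S(β), and every point of S(β) has a geodesic running through it; so
inclusion need only be tested there. -/
theorem successorSet_subset_iff (hG : G.IsTree) {α β : G.edgeSet} {v : V}
    (hv : IsFarEnd r β v) :
    successorSet r β ⊆ successorSet r α ↔ α ∈ geodesicEdges G r v := by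
  constructor
  · intro h
    exact h (show ClosedTree.vertex v (farEnd_ne hG hv) ∈ successorSet r β from
      mem_geodesicEdges_farEnd hG hv)
  · exact fun h x hx => geodesicEdges_farEnd_subset hG hx hv h

theorem edgesBelow_eq (hG : G.IsTree) (α : G.edgeSet) :
    edgesBelow r α = {β | successorSet r β ⊆ successorSet r α} := by
  ext β
  constructor
  · rintro ⟨v, hv, h⟩
    exact (successorSet_subset_iff hG hv).2 h
  · intro h
    obtain ⟨v, hv⟩ := exists_farEnd (r := r) hG β
    exact ⟨v, hv, (successorSet_subset_iff hG hv).1 h⟩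

theorem successorSet_nonempty (hG : G.IsTree) (α : G.edgeSet) : (successorSet r α).Nonempty := by
  obtain ⟨v, hv⟩ := exists_farEnd (r := r) hG α
  exact ⟨.vertex v (farEnd_ne hG hv), mem_geodesicEdges_farEnd hG hv⟩

theorem successorSet_nested (hG : G.IsTree) {x : ClosedTree G r} {α β : G.edgeSet}
    (hα : x ∈ successorSet r α) (hβ : x ∈ successorSet r β) :
    successorSet r α ⊆ successorSet r β ∨ successorSet r β ⊆ successorSet r α := by
  obtain ⟨a, ha⟩ := exists_farEnd (r := r) hG α
  obtain ⟨b, hb⟩ := exists_farEnd (r := r) hG β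
  rw [successorSet_subset_iff hG ha, successorSet_subset_iff hG hb]
  obtain ⟨v, ⟨p, hp, h1⟩, h2, -⟩ := x.exists_vertex hG hα hβ
  exact (mem_edges_farEnd_or hG p hp h1 ((mem_geodesicEdges_iff hG hp).1 h2) ha hb).symm

/-- If the sets agree, each far end lies on the geodesic to the other. Were the far ends different,
each geodesic would be strictly shorter than the other; hence they coincide, and so do the last
edges of the unique path. -/
theorem successorSet_injective (hG : G.IsTree) :
    Function.Injective (successorSet r : G.edgeSet → Set (ClosedTree G r)) := by
  classical
  intro α β h
  obtain ⟨a, b, hab, p, hp, hα, hb⟩ := exists_path_to_farEnd (r := r) hG α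
  obtain ⟨c, d, hcd, q, hq, hβ, hd⟩ := exists_path_to_farEnd (r := r) hG β
  have h1 := (successorSet_subset_iff hG ((hb b).2 rfl)).1 h.le
  have h2 := (successorSet_subset_iff hG ((hd d).2 rfl)).1 h.ge
  rw [mem_geodesicEdges_iff hG hp, hβ] at h1
  rw [mem_geodesicEdges_iff hG hq, hα] at h2
  have h3 : d ∈ (p.concat hab).support := Walk.mem_support_of_mem_edges h1 (Sym2.mem_mk_right _ _)
  have h4 : b ∈ (q.concat hcd).support := Walk.mem_support_of_mem_edges h2 (Sym2.mem_mk_right _ _)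
  have hbd : d = b := by
    by_contra hne
    have h5 := Walk.length_takeUntil_lt_length h3 hne
    have h6 := Walk.length_takeUntil_lt_length h4 (Ne.symm hne)
    rw [path_unique hG (hp.takeUntil h3) hq] at h5
    rw [path_unique hG (hq.takeUntil h4) hp] at h6
    omega
  subst hbd
  obtain ⟨rfl, -⟩ := Walk.concat_inj (path_unique hG hp hq)
  exact Subtype.ext (hα.trans hβ.symm)

/-- Countability is what lets the integral commute with the supremum over finite sets of edges. -/
theorem countable_of_locallyFinite (hG : G.Connected) (hfin : ∀ v, (G.neighborSet v).Finite)
    (r : V) : Countable V := by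
  have h : ∀ n, {v | ∃ p : G.Walk r v, p.length = n}.Countable := by
    intro n
    induction n with
    | zero =>
      refine (Set.countable_singleton r).mono ?_
      rintro v ⟨p, hp⟩
      exact (Walk.eq_of_length_eq_zero hp).symm
    | succ n ih =>
      refine (ih.biUnion fun v _ => (hfin v).countable).mono ?_
      rintro v ⟨p, hp⟩
      obtain ⟨u, q, h, rfl⟩ : ∃ (u : V) (q : G.Walk r u) (h : G.Adj u v), p = q.concat h := by
        cases p with
        | nil => simp at hp
        | cons h p =>
          obtain ⟨u, q, h', e⟩ := Walk.exists_cons_eq_concat h p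
          exact ⟨u, q, h', e⟩
      rw [Walk.length_concat] at hp
      exact Set.mem_biUnion (show u ∈ {v | ∃ p : G.Walk r v, p.length = n} from
        ⟨q, by omega⟩) h
  rw [← Set.countable_univ_iff]
  refine (Set.countable_iUnion h).mono fun v _ => ?_
  obtain ⟨p⟩ := hG.preconnected r v
  exact Set.mem_iUnion.2 ⟨p.length, p, rfl⟩

end Graph

/-! ### The one-variable integral attached to a single edge. -/

section EdgeIntegral

open MeasureTheory

/-- With g(t) = t - a²/t, the integrand is 2p g^(p-1) - (g^p)'. Since g ≤ 2(t - a), the first term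
is at most the derivative of 2^p (t - a)^p. The subtracted g(b)^p is what later absorbs the tail t >
b exactly. -/
theorem integral_middle_le {p a b : ℝ} (hp : 1 < p) (ha : 0 ≤ a) (hab : a ≤ b) :
    ∫⁻ t in Set.Ioc a b, ENNReal.ofReal (p * ((t - a ^ 2 / t) ^ (p - 1) * (1 - a ^ 2 / t ^ 2))) ≤
      ENNReal.ofReal (2 ^ p * (b - a) ^ p - (b - a ^ 2 / b) ^ p) := by
  have hcont : ∀ n : ℕ, ContinuousOn (fun t : ℝ => a ^ 2 / t ^ n) (Set.Icc a b) := by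
    intro n
    rcases ha.eq_or_lt with rfl | ha
    -- For a = 0 the quotient is identically 0, including at t = 0, where division by zero gives 0.
    · simpa using continuousOn_const
    · exact continuousOn_const.div (by fun_prop) fun t ht => (pow_pos (ha.trans_le ht.1) n).ne'
  have hcont1 : ContinuousOn (fun t : ℝ => t - a ^ 2 / t) (Set.Icc a b) :=
    continuousOn_id.sub (by simpa using hcont 1)
  have hG : ∀ t, a < t → 0 < t - a ^ 2 / t := by
    intro t ht
    have : 0 < t := ha.trans_lt ht
    rw [sub_pos, div_lt_iff₀ this]
    nlinarith
  have hphi : ContinuousOn (fun t : ℝ => p * ((t - a ^ 2 / t) ^ (p - 1) * (1 - a ^ 2 / t ^ 2)))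
      (Set.Icc a b) :=
    continuousOn_const.mul ((hcont1.rpow_const fun _ _ => Or.inr (by linarith)).mul
      (continuousOn_const.sub (hcont 2)))
  have hint := hphi.integrableOn_Icc (μ := volume)
  rw [← ofReal_integral_eq_lintegral_ofReal (hint.mono_set Set.Ioc_subset_Icc_self)]
  · refine ENNReal.ofReal_le_ofReal ?_
    have key := intervalIntegral.integral_le_sub_of_hasDeriv_right_of_le
      (g := fun t => 2 ^ p * (t - a) ^ p - (t - a ^ 2 / t) ^ p)
      (g' := fun t => 2 ^ p * (1 * p * (t - a) ^ (p - 1)) -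
        (1 + a ^ 2 / t ^ 2) * p * (t - a ^ 2 / t) ^ (p - 1)) hab
      ?_ ?_ hint ?_
    · rw [intervalIntegral.integral_of_le hab] at key
      refine key.trans (le_of_eq ?_)
      have h0 : a - a ^ 2 / a = 0 := by
        rcases ha.eq_or_lt with rfl | ha
        · simp
        · field_simp
          ring
      simp [h0, Real.zero_rpow (show p ≠ 0 by linarith)]
    · refine (continuousOn_const.mul ?_).sub (hcont1.rpow_const fun _ _ => Or.inr (by linarith))
      exact (continuousOn_id.sub continuousOn_const).rpow_const fun _ _ => Or.inr (by linarith)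
    · intro t ht
      have ht0 : 0 < t := ha.trans_lt ht.1
      refine HasDerivAt.hasDerivWithinAt (HasDerivAt.sub ?_ ?_)
      · exact (((hasDerivAt_id t).sub_const a).rpow_const (Or.inr hp.le)).const_mul _
      · refine HasDerivAt.rpow_const ?_ (Or.inr hp.le)
        simp only [div_eq_mul_inv]
        refine ((hasDerivAt_id' t).sub ((hasDerivAt_inv ht0.ne').const_mul (a ^ 2))).congr_deriv ?_
        ring
    · intro t ht
      have ht0 : 0 < t := ha.trans_lt ht.1
      have h1 : t - a ^ 2 / t ≤ 2 * (t - a) := by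
        have : t - a ^ 2 / t = (t - a) * ((t + a) / t) := by
          field_simp
          ring
        rw [this, mul_comm 2]
        refine mul_le_mul_of_nonneg_left ?_ (by linarith [ht.1])
        rw [div_le_iff₀ ht0]
        linarith [ht.1]
      have h2 := Real.rpow_le_rpow (hG t ht.1).le h1 (show 0 ≤ p - 1 by linarith)
      rw [Real.mul_rpow two_pos.le (by linarith [ht.1])] at h2
      have h3 : (2 : ℝ) ^ p = 2 * 2 ^ (p - 1) := by
        rw [Real.rpow_sub_one two_ne_zero]
        ring
      rw [h3]
      nlinarith [mul_le_mul_of_nonneg_left h2 (show 0 ≤ 2 * p by linarith)]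
  · refine (ae_restrict_iff' measurableSet_Ioc).2 (.of_forall fun t ht => ?_)
    have ht0 : 0 < t := ha.trans_lt ht.1
    have h1 : 0 ≤ 1 - a ^ 2 / t ^ 2 := by
      rw [sub_nonneg, div_le_one (by positivity)]
      exact pow_le_pow_left₀ ha ht.1.le 2
    exact mul_nonneg (by linarith) (mul_nonneg (Real.rpow_nonneg (hG t ht.1).le _) h1)

/-- The estimate for a single edge that bounds the capacitary integral: the level-`t` test
function for `u` is `min(u, t)² / t²`, and the edge carries the increment of `u` from `a` to `b`. -/
theorem lintegral_sq_truncation_le {p a b : ℝ} (hp : 1 < p) (ha : 0 ≤ a) (hab : a ≤ b) :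
    ∫⁻ t in Set.Ioi 0,
      ENNReal.ofReal (p * (t ^ (p - 1) * ((min b t ^ 2 - min a t ^ 2) / t ^ 2) ^ p)) ≤
      ENNReal.ofReal (2 ^ p * (b - a) ^ p) := by
  have hp0 : p ≠ 0 := by linarith
  rcases hab.eq_or_lt with rfl | hab'
  · simp [Real.zero_rpow hp0]
  have hb : 0 < b := ha.trans_lt hab'
  have hGb : 0 ≤ b - a ^ 2 / b := by
    rw [sub_nonneg, div_le_iff₀ hb]
    nlinarith
  have hsplit : Set.Ioi (0 : ℝ) = Set.Ioc 0 a ∪ (Set.Ioc a b ∪ Set.Ioi b) := by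
    rw [Set.Ioc_union_Ioi_eq_Ioi hab, Set.Ioc_union_Ioi_eq_Ioi ha]
  have hlow : ∫⁻ t in Set.Ioc 0 a,
      ENNReal.ofReal (p * (t ^ (p - 1) * ((min b t ^ 2 - min a t ^ 2) / t ^ 2) ^ p)) = 0 := by
    rw [setLIntegral_congr_fun (g := fun _ => 0) measurableSet_Ioc fun t ht => ?_]
    · simp
    · simp [min_eq_right ht.2, min_eq_right (ht.2.trans hab), Real.zero_rpow hp0]
  have hmid : ∫⁻ t in Set.Ioc a b,
      ENNReal.ofReal (p * (t ^ (p - 1) * ((min b t ^ 2 - min a t ^ 2) / t ^ 2) ^ p)) ≤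
      ENNReal.ofReal (2 ^ p * (b - a) ^ p - (b - a ^ 2 / b) ^ p) := by
    rw [setLIntegral_congr_fun measurableSet_Ioc fun t ht => ?_]
    · exact integral_middle_le hp ha hab
    · have ht0 : 0 < t := ha.trans_lt ht.1
      have hG : 0 < t - a ^ 2 / t := by
        rw [sub_pos, div_lt_iff₀ ht0]
        nlinarith [ht.1]
      have e1 : (t ^ 2 - a ^ 2) / t ^ 2 = (t - a ^ 2 / t) / t := by
        field_simp
      have e2 : 1 - a ^ 2 / t ^ 2 = (t - a ^ 2 / t) / t := by
        field_simp
      simp only [min_eq_right ht.2, min_eq_left ht.1.le, e1, e2]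
      rw [Real.div_rpow hG.le ht0.le, Real.rpow_sub_one hG.ne', Real.rpow_sub_one ht0.ne']
      congr 2
      have := Real.rpow_pos_of_pos ht0 p
      generalize t - a ^ 2 / t = g at hG ⊢
      field_simp
  -- Beyond b the square gives decay t^(-p-1), and the integral is exactly the term subtracted in
  -- the middle range.
  have hhigh : ∫⁻ t in Set.Ioi b,
      ENNReal.ofReal (p * (t ^ (p - 1) * ((min b t ^ 2 - min a t ^ 2) / t ^ 2) ^ p)) =
      ENNReal.ofReal ((b - a ^ 2 / b) ^ p) := by
    have hab2 : 0 ≤ b ^ 2 - a ^ 2 := by nlinarith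
    rw [setLIntegral_congr_fun (g := fun t : ℝ =>
      ENNReal.ofReal (p * (b ^ 2 - a ^ 2) ^ p * t ^ (-p - 1))) measurableSet_Ioi fun t ht => ?_]
    · rw [← ofReal_integral_eq_lintegral_ofReal, integral_const_mul,
        integral_Ioi_rpow_of_lt (by linarith) hb]
      · congr 1
        have e : b - a ^ 2 / b = (b ^ 2 - a ^ 2) / b := by
          field_simp
        rw [e, Real.div_rpow hab2 hb.le, sub_add_cancel, Real.rpow_neg hb.le]
        field_simp
      · exact (integrableOn_Ioi_rpow_of_lt (by linarith) hb).const_mul _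
      · refine (ae_restrict_iff' measurableSet_Ioi).2 (.of_forall fun t ht => ?_)
        have : 0 < t := hb.trans ht
        simp only [Pi.zero_apply]
        positivity
    · have ht' : b < t := ht
      have ht0 : 0 < t := hb.trans ht'
      simp only [min_eq_left ht'.le, min_eq_left (hab.trans ht'.le)]
      rw [Real.div_rpow hab2 (by positivity), ← Real.rpow_natCast t 2, ← Real.rpow_mul ht0.le,
        mul_assoc, mul_div_left_comm, ← Real.rpow_sub ht0]
      congr 4
      push_cast
      ring
  -- Truncated at 0, `ENNReal.ofReal` adds correctly only if the middle bound is nonnegative.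
  have hle : (b - a ^ 2 / b) ^ p ≤ 2 ^ p * (b - a) ^ p := by
    rw [← Real.mul_rpow two_pos.le (by linarith)]
    refine Real.rpow_le_rpow hGb ?_ (by linarith)
    rw [sub_le_iff_le_add, ← sub_le_iff_le_add', le_div_iff₀ hb]
    nlinarith [sq_nonneg (b - a)]
  rw [hsplit]
  refine (lintegral_union_le _ _ _).trans ?_
  rw [hlow, zero_add]
  refine (lintegral_union_le _ _ _).trans ?_
  rw [hhigh]
  refine (add_le_add_left hmid _).trans ?_
  rw [← ENNReal.ofReal_add (by linarith) (by positivity), sub_add_cancel]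

end EdgeIntegral

/-! ### Telescoping in laminar families and the capacitary bound. -/

section Abstract

open MeasureTheory

variable {X E : Type*} {S : E → Set X}

open Classical in
/-- Telescoping along a finite chain of sets. -/
theorem sum_chain_telescope (hinj : Function.Injective S) (φ : E → ℝ) (f : ℝ → ℝ) (K : Finset E)
    (hK : ∀ α ∈ K, ∀ β ∈ K, S α ⊆ S β ∨ S β ⊆ S α) :
    ∑ α ∈ K, (f (∑ β ∈ K with S α ⊆ S β, φ β) - f (∑ β ∈ K with S α ⊂ S β, φ β)) =
      f (∑ β ∈ K, φ β) - f 0 := by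
  induction K using Finset.strongInduction with
  | H K ih =>
    rcases K.eq_empty_or_nonempty with rfl | hne
    · simp
    -- The smallest set is removed: it contains no other set of the chain, so the remaining terms
    -- are unchanged.
    obtain ⟨m, hm, hmin⟩ := K.exists_minimalFor S hne
    have hle : ∀ α ∈ K, S m ⊆ S α := fun α hα => (hK m hm α hα).elim id fun h => hmin hα h
    have hlt : ∀ α ∈ K, α ≠ m → ¬ S α ⊆ S m := fun α hα h h' =>
      h (hinj (h'.antisymm (hle α hα)))
    have h1 : {β ∈ K | S m ⊆ S β} = K := Finset.filter_true_of_mem hle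
    have h2 : {β ∈ K | S m ⊂ S β} = K.erase m := by
      ext β
      simp only [Finset.mem_filter, Finset.mem_erase, ssubset_iff_subset_not_subset]
      constructor
      · rintro ⟨h, -, h'⟩
        exact ⟨fun e => h' (e ▸ subset_rfl), h⟩
      · rintro ⟨h, h'⟩
        exact ⟨h', hle β h', hlt β h' h⟩
    have h3 := ih (K.erase m) (Finset.erase_ssubset hm) fun α hα β hβ =>
      hK α (Finset.mem_of_mem_erase hα) β (Finset.mem_of_mem_erase hβ)
    rw [← Finset.add_sum_erase K _ hm, h1, h2, ← sub_add_sub_cancel (f (∑ β ∈ K, φ β)) (f (∑ β ∈ K.erase m, φ β)) (f 0),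
      ← h3]
    congr 1
    refine Finset.sum_congr rfl fun α hα => ?_
    obtain ⟨hα1, hα2⟩ := Finset.mem_erase.1 hα
    have h4 : {β ∈ K | S α ⊆ S β} = {β ∈ K.erase m | S α ⊆ S β} := by
      rw [Finset.filter_erase, Finset.erase_eq_of_notMem]
      simp [hlt α hα2 hα1]
    have h5 : {β ∈ K | S α ⊂ S β} = {β ∈ K.erase m | S α ⊂ S β} := by
      rw [Finset.filter_erase, Finset.erase_eq_of_notMem]
      exact fun h => hlt α hα2 hα1 (Finset.mem_filter.1 h).2.subset
    rw [h4, h5]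

variable (S) in
open Classical in
/-- The sum of `φ` over the sets of the subfamily `F` that contain `S α`. -/
noncomputable def sumUp (F : Finset E) (φ : E → ℝ≥0) (α : E) : ℝ :=
  ∑ β ∈ F with S α ⊆ S β, (φ β : ℝ)

variable (S) in
open Classical in
/-- The sum of `φ` over the sets of the subfamily `F` that strictly contain `S α`. -/
noncomputable def sumAbove (F : Finset E) (φ : E → ℝ≥0) (α : E) : ℝ :=
  ∑ β ∈ F with S α ⊂ S β, (φ β : ℝ)

variable (S) in
open Classical in
/-- The sum of `φ` over the sets of the subfamily `F` that contain the point `x`. -/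
noncomputable def sumAt (F : Finset E) (φ : E → ℝ≥0) (x : X) : ℝ :=
  ∑ β ∈ F with x ∈ S β, (φ β : ℝ)

variable {F : Finset E} {φ : E → ℝ≥0}

theorem sumAbove_nonneg (α : E) : 0 ≤ sumAbove S F φ α :=
  Finset.sum_nonneg fun _ _ => NNReal.coe_nonneg _

theorem sumAt_nonneg (x : X) : 0 ≤ sumAt S F φ x :=
  Finset.sum_nonneg fun _ _ => NNReal.coe_nonneg _

theorem sumUp_eq (hinj : Function.Injective S) {α : E} (hα : α ∈ F) :
    sumUp S F φ α = sumAbove S F φ α + φ α := by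
  classical
  unfold sumUp sumAbove
  rw [← Finset.sum_erase_add (a := α) _ _ (by simp [hα])]
  congr 2
  ext β
  simp only [Finset.mem_erase, Finset.mem_filter]
  constructor
  · rintro ⟨h, h', h''⟩
    exact ⟨h', h''.ssubset_of_ne fun e => h (hinj e).symm⟩
  · rintro ⟨h, h'⟩
    exact ⟨fun e => h'.ne (by rw [e]), h, h'.subset⟩

theorem sumAbove_le_sumUp (α : E) : sumAbove S F φ α ≤ sumUp S F φ α := by
  refine Finset.sum_le_sum_of_subset_of_nonneg (fun β hβ => ?_) fun _ _ _ => NNReal.coe_nonneg _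
  simp only [Finset.mem_filter] at hβ ⊢
  exact ⟨hβ.1, hβ.2.subset⟩

theorem sumUp_nonneg (α : E) : 0 ≤ sumUp S F φ α :=
  (sumAbove_nonneg α).trans (sumAbove_le_sumUp α)

theorem sumUp_le_sumAt {α : E} {x : X} (hx : x ∈ S α) : sumUp S F φ α ≤ sumAt S F φ x := by
  refine Finset.sum_le_sum_of_subset_of_nonneg (fun β hβ => ?_) fun _ _ _ => NNReal.coe_nonneg _
  simp only [Finset.mem_filter] at hβ ⊢
  exact ⟨hβ.1, hβ.2 hx⟩

theorem sumUp_le_sumAbove {α β : E} (h : S α ⊂ S β) : sumUp S F φ β ≤ sumAbove S F φ α := by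
  refine Finset.sum_le_sum_of_subset_of_nonneg (fun γ hγ => ?_) fun _ _ _ => NNReal.coe_nonneg _
  simp only [Finset.mem_filter] at hγ ⊢
  exact ⟨hγ.1, h.trans_subset hγ.2⟩

/-- All supersets in F of a member of K are already in K, so the sums over F are sums over the chain
K. -/
theorem sum_telescope_of_upClosed (hinj : Function.Injective S) (f : ℝ → ℝ) {K : Finset E}
    (hKF : K ⊆ F) (hK : ∀ α ∈ K, ∀ β ∈ K, S α ⊆ S β ∨ S β ⊆ S α)
    (hup : ∀ α ∈ K, ∀ β ∈ F, S α ⊆ S β → β ∈ K) :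
    ∑ α ∈ K, (f (sumUp S F φ α) - f (sumAbove S F φ α)) = f (∑ β ∈ K, (φ β : ℝ)) - f 0 := by
  classical
  rw [← sum_chain_telescope hinj (fun β => (φ β : ℝ)) f K hK]
  refine Finset.sum_congr rfl fun α hα => ?_
  unfold sumUp sumAbove
  congr 3 <;>
  · ext β
    simp only [Finset.mem_filter]
    refine and_congr_left fun h => ⟨fun h' => hup α hα β h' ?_, fun h' => hKF h'⟩
    first | exact h | exact h.subset

open Classical in
theorem sum_telescope_at (hinj : Function.Injective S)
    (hnest : ∀ x α β, x ∈ S α → x ∈ S β → S α ⊆ S β ∨ S β ⊆ S α) (f : ℝ → ℝ) (x : X) :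
    ∑ α ∈ F with x ∈ S α, (f (sumUp S F φ α) - f (sumAbove S F φ α)) =
      f (sumAt S F φ x) - f 0 := by
  refine sum_telescope_of_upClosed hinj f (Finset.filter_subset _ _) ?_ ?_
  · intro α hα β hβ
    exact hnest x α β (Finset.mem_filter.1 hα).2 (Finset.mem_filter.1 hβ).2
  · intro α hα β hβ h
    exact Finset.mem_filter.2 ⟨hβ, h (Finset.mem_filter.1 hα).2⟩

open Classical in
theorem sum_telescope_up (hinj : Function.Injective S)
    (hnest : ∀ x α β, x ∈ S α → x ∈ S β → S α ⊆ S β ∨ S β ⊆ S α)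
    (hne : ∀ α, (S α).Nonempty) (f : ℝ → ℝ) (γ : E) :
    ∑ α ∈ F with S γ ⊆ S α, (f (sumUp S F φ α) - f (sumAbove S F φ α)) =
      f (sumUp S F φ γ) - f 0 := by
  obtain ⟨x, hx⟩ := hne γ
  refine sum_telescope_of_upClosed hinj f (Finset.filter_subset _ _) ?_ ?_
  · intro α hα β hβ
    exact hnest x α β ((Finset.mem_filter.1 hα).2 hx) ((Finset.mem_filter.1 hβ).2 hx)
  · intro α hα β hβ h
    exact Finset.mem_filter.2 ⟨hβ, (Finset.mem_filter.1 hα).2.trans h⟩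

theorem sum_indicator_eq_ofReal (x : X) :
    ∑ α ∈ F, (S α).indicator (fun _ => (φ α : ℝ≥0∞)) x = ENNReal.ofReal (sumAt S F φ x) := by
  classical
  rw [sumAt, ENNReal.ofReal_sum_of_nonneg fun _ _ => NNReal.coe_nonneg _, Finset.sum_filter]
  simp [Set.indicator_apply]

variable [MeasurableSpace X]

theorem measurable_sumAt (hmeas : ∀ α, MeasurableSet (S α)) : Measurable (sumAt S F φ) := by
  have : sumAt S F φ = fun x => ∑ α ∈ F, (S α).indicator (fun _ => (φ α : ℝ)) x := by
    classical
    ext x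
    simp [sumAt, Finset.sum_filter, Set.indicator_apply]
  rw [this]
  exact Finset.measurable_sum _ fun α _ => measurable_const.indicator (hmeas α)

/-- The capacitary estimate: if `∑ μ(S α) ≤ c ‖ψ‖^p` over disjoint families on which the Hardy
transform of `ψ` is at least `1`, then the Hardy inequality holds with constant `2 ^ p * c`. -/
theorem lintegral_le_of_isocapacitary (hinj : Function.Injective S)
    (hnest : ∀ x α β, x ∈ S α → x ∈ S β → S α ⊆ S β ∨ S β ⊆ S α)
    (hmeas : ∀ α, MeasurableSet (S α)) {p : ℝ} (hp : 1 < p) (π : E → ℝ≥0) (μ : Measure X)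
    (F : Finset E) (φ : E → ℝ≥0) (c : ℝ≥0∞)
    (hc : ∀ (T : Finset E) (ψ : E → ℝ≥0),
      (∀ α ∈ T, ∀ β ∈ T, α ≠ β → Disjoint (S α) (S β)) →
      (∀ α ∈ T, ∀ x ∈ S α, 1 ≤ ∑ β ∈ F, (S β).indicator (fun _ => (ψ β : ℝ≥0∞)) x) →
      ∑ α ∈ T, μ (S α) ≤ c * ∑ α ∈ F, (ψ α : ℝ≥0∞) ^ p * π α) :
    ∫⁻ x, (∑ α ∈ F, (S α).indicator (fun _ => (φ α : ℝ≥0∞)) x) ^ p ∂μ ≤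
      2 ^ p * c * ∑ α ∈ F, (φ α : ℝ≥0∞) ^ p * π α := by
  classical
  have hp0 : 0 < p := by linarith
  set D : E → ℝ → ℝ := fun α t =>
    (min (sumUp S F φ α) t ^ 2 - min (sumAbove S F φ α) t ^ 2) / t ^ 2 with hD
  have hDnn : ∀ α t, 0 < t → 0 ≤ D α t := fun α t ht => by
    refine div_nonneg (sub_nonneg.2 ?_) (sq_nonneg t)
    exact pow_le_pow_left₀ (le_min (sumAbove_nonneg α) ht.le)
      (min_le_min_right t (sumAbove_le_sumUp α)) 2
  have hlevel : ∀ t, 0 < t →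
      μ {x | t ≤ sumAt S F φ x} ≤ c * ∑ α ∈ F, ENNReal.ofReal (D α t) ^ p * π α := by
    intro t ht
    -- The edges on which u first reaches level t.
    set T : Finset E := {α ∈ F | t ≤ sumUp S F φ α ∧ sumAbove S F φ α < t} with hT
    have hcover : {x | t ≤ sumAt S F φ x} ⊆ ⋃ α ∈ T, S α := by
      intro x hx
      -- Telescoping the step function at t: the increments sum to 1, so one is nonzero, and its
      -- edge crosses level t.
      have h := sum_telescope_at (F := F) (φ := φ) hinj hnest
        (fun s => if t ≤ s then (1 : ℝ) else 0) x
      simp only [Set.mem_ofPred_eq] at hx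
      rw [if_pos hx, if_neg (not_le.2 ht), sub_zero] at h
      obtain ⟨α, hα, hne⟩ := Finset.exists_ne_zero_of_sum_ne_zero (h.trans_ne one_ne_zero)
      obtain ⟨hα1, hα2⟩ := Finset.mem_filter.1 hα
      refine Set.mem_biUnion (x := α) ?_ hα2
      have h3 := sumAbove_le_sumUp (S := S) (F := F) (φ := φ) α
      refine Finset.mem_coe.2 (Finset.mem_filter.2 ⟨hα1, ?_, ?_⟩)
      · by_contra h1
        exact hne (by rw [if_neg h1, if_neg (fun h2 => h1 (h2.trans h3)), sub_zero])
      · by_contra h1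
        rw [not_lt] at h1
        exact hne (by rw [if_pos h1, if_pos (h1.trans h3), sub_self])
    calc μ {x | t ≤ sumAt S F φ x} ≤ ∑ α ∈ T, μ (S α) :=
          (measure_mono hcover).trans (measure_biUnion_finset_le _ _)
      _ ≤ _ := by
        refine hc T (fun α => (D α t).toNNReal) ?_ ?_
        · intro α hα β hβ hαβ
          have aux : ∀ α ∈ T, ∀ β ∈ T, α ≠ β → ¬ S α ⊆ S β := fun α hα β hβ hαβ h => by
            have h1 := sumUp_le_sumAbove (F := F) (φ := φ)
              (h.ssubset_of_ne fun e => hαβ (hinj e))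
            linarith [(Finset.mem_filter.1 hα).2.2, (Finset.mem_filter.1 hβ).2.1]
          refine Set.disjoint_left.2 fun x hx hx' => ?_
          rcases hnest x α β hx hx' with h | h
          · exact aux α hα β hβ hαβ h
          · exact aux β hβ α hα hαβ.symm h
        · intro α hα x hx
          rw [sum_indicator_eq_ofReal, ENNReal.one_le_ofReal, sumAt]
          -- Admissibility: the increments sum to min(u(x), t)²/t², which is 1 because u(x) ≥ t.
          have h := sum_telescope_at (F := F) (φ := φ) hinj hnest (fun s => min s t ^ 2 / t ^ 2) x
          have hx' : t ≤ sumAt S F φ x := (Finset.mem_filter.1 hα).2.1.trans (sumUp_le_sumAt hx)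
          rw [min_eq_right hx', min_eq_left ht.le, div_self (by positivity)] at h
          simp only [ne_eq, OfNat.ofNat_ne_zero, not_false_eq_true, zero_pow, zero_div,
            sub_zero] at h
          refine h.ge.trans (le_of_eq (Finset.sum_congr rfl fun β _ => ?_))
          rw [Real.coe_toNNReal _ (hDnn β t ht), hD]
          simp only [sub_div]
  have hDm : ∀ α, Measurable fun t => ENNReal.ofReal (p * (t ^ (p - 1) * D α t ^ p)) := by
    intro α
    simp only [hD]
    fun_prop
  have hlayer : ∫⁻ x, (∑ α ∈ F, (S α).indicator (fun _ => (φ α : ℝ≥0∞)) x) ^ p ∂μ =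
      ENNReal.ofReal p * ∫⁻ t in Set.Ioi 0,
        μ {x | t ≤ sumAt S F φ x} * ENNReal.ofReal (t ^ (p - 1)) := by
    rw [← lintegral_rpow_eq_lintegral_meas_le_mul μ (.of_forall fun x => sumAt_nonneg x)
      (measurable_sumAt hmeas).aemeasurable hp0]
    refine lintegral_congr fun x => ?_
    rw [sum_indicator_eq_ofReal, ENNReal.ofReal_rpow_of_nonneg (sumAt_nonneg x) hp0.le]
  rw [hlayer, ← lintegral_const_mul' _ _ ENNReal.ofReal_ne_top]
  calc ∫⁻ t in Set.Ioi 0, ENNReal.ofReal p *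
        (μ {x | t ≤ sumAt S F φ x} * ENNReal.ofReal (t ^ (p - 1)))
      ≤ ∫⁻ t in Set.Ioi 0, ∑ α ∈ F,
          c * π α * ENNReal.ofReal (p * (t ^ (p - 1) * D α t ^ p)) := by
        refine setLIntegral_mono' measurableSet_Ioi fun t ht => ?_
        have ht0 : (0 : ℝ) < t := ht
        calc _ ≤ ENNReal.ofReal p * ((c * ∑ α ∈ F, ENNReal.ofReal (D α t) ^ p * π α) *
              ENNReal.ofReal (t ^ (p - 1))) := by
              gcongr
              exact hlevel t ht0
          _ = _ := by
              rw [Finset.mul_sum, Finset.sum_mul, Finset.mul_sum]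
              refine Finset.sum_congr rfl fun α _ => ?_
              rw [ENNReal.ofReal_mul hp0.le, ENNReal.ofReal_mul (by positivity),
                ENNReal.ofReal_rpow_of_nonneg (hDnn α t ht0) hp0.le]
              ring
    _ = ∑ α ∈ F, c * π α *
          ∫⁻ t in Set.Ioi 0, ENNReal.ofReal (p * (t ^ (p - 1) * D α t ^ p)) := by
        rw [lintegral_finsetSum _ fun α _ => (hDm α).const_mul _]
        exact Finset.sum_congr rfl fun α _ => lintegral_const_mul _ (hDm α)
    _ ≤ ∑ α ∈ F, c * π α * (2 ^ p * (φ α : ℝ≥0∞) ^ p) := by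
        refine Finset.sum_le_sum fun α hα => ?_
        gcongr
        refine (lintegral_sq_truncation_le hp (sumAbove_nonneg α)
          (sumAbove_le_sumUp α)).trans (le_of_eq ?_)
        rw [sumUp_eq hinj hα, add_sub_cancel_left, ENNReal.ofReal_mul (by positivity),
          ← ENNReal.ofReal_rpow_of_nonneg (by positivity) hp0.le,
          ← ENNReal.ofReal_rpow_of_nonneg (by positivity) hp0.le]
        simp
    _ = _ := by
        rw [Finset.mul_sum]
        exact Finset.sum_congr rfl fun α _ => by ring

end Abstract

/-! ### Mass-energy and Hardy: both implications by Hölder. -/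

section MassEnergy

open MeasureTheory

variable {X E : Type*} {S : E → Set X}

/-- Convexity: s^p lies above its tangent at b. This is Bernoulli's inequality at a/b. -/
theorem rpow_sub_rpow_le {p a b : ℝ} (hp : 1 < p) (ha : 0 ≤ a) (hab : a ≤ b) :
    b ^ p - a ^ p ≤ p * ((b - a) * b ^ (p - 1)) := by
  rcases (ha.trans hab).eq_or_lt with rfl | hb
  · obtain rfl := le_antisymm hab ha
    simp
  have h := one_add_mul_self_le_rpow_one_add (s := a / b - 1)
    (by linarith [div_nonneg ha hb.le]) hp.le
  rw [add_sub_cancel, Real.div_rpow ha hb.le, le_div_iff₀ (Real.rpow_pos_of_pos hb p)] at h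
  have e : b ^ p = b * b ^ (p - 1) := by
    rw [Real.rpow_sub_one hb.ne']
    field_simp
  rw [e] at h ⊢
  have e2 : (1 + p * (a / b - 1)) * (b * b ^ (p - 1)) =
      b * b ^ (p - 1) - p * ((b - a) * b ^ (p - 1)) := by
    field_simp
    ring
  linarith

/-- Solving `X ≤ A E^{1/p} (M X)^{1/q}` for a finite `X`. -/
theorem le_of_le_mul_rpow {p q : ℝ} (hpq : p.HolderConjugate q) {X A M e : ℝ≥0∞} (hX : X ≠ ∞)
    (h : X ≤ A * (e ^ (1 / p) * (M * X) ^ (1 / q))) : X ≤ A ^ p * M ^ (p - 1) * e := by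
  have hp := hpq.lt
  rcases eq_or_ne X 0 with rfl | hX0
  · exact zero_le
  have hpp : p * (1 / q) = p - 1 := by
    have := hpq.mul_eq_add
    have := hpq.symm.pos
    field_simp
    linarith
  have h' := ENNReal.rpow_le_rpow h hpq.nonneg
  rw [ENNReal.mul_rpow_of_nonneg _ _ hpq.nonneg, ENNReal.mul_rpow_of_nonneg _ _ hpq.nonneg,
    ← ENNReal.rpow_mul, ← ENNReal.rpow_mul, one_div_mul_cancel hpq.ne_zero, ENNReal.rpow_one,
    mul_comm (1 / q) p, hpp, ENNReal.mul_rpow_of_nonneg _ _ (by linarith)] at h'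
  have e1 : X ^ p = X * X ^ (p - 1) := by
    nth_rw 2 [← ENNReal.rpow_one X]
    rw [← ENNReal.rpow_add _ _ hX0 hX, add_sub_cancel]
  rw [e1] at h'
  have h'' : X * X ^ (p - 1) ≤ A ^ p * M ^ (p - 1) * e * X ^ (p - 1) :=
    h'.trans (le_of_eq (by ring))
  refine (ENNReal.mul_le_mul_iff_left ?_ ?_).1 h''
  · simp [ENNReal.rpow_eq_zero_iff, hX0, hX]
  · exact ENNReal.rpow_ne_top_of_nonneg (by linarith) hX

variable [MeasurableSpace X]

/-- The mass-energy condition with constant `M` gives the Hardy inequality with constant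
`p ^ p * M ^ (p - 1)`. -/
theorem lintegral_le_of_massEnergy (hinj : Function.Injective S)
    (hnest : ∀ x α β, x ∈ S α → x ∈ S β → S α ⊆ S β ∨ S β ⊆ S α)
    (hne : ∀ α, (S α).Nonempty)
    (hmeas : ∀ α, MeasurableSet (S α)) {p q : ℝ} (hpq : p.HolderConjugate q) (π : E → ℝ≥0)
    (μ : Measure X) [IsFiniteMeasure μ] (F : Finset E) (φ : E → ℝ≥0) {M : ℝ≥0∞} (hM : M ≠ ∞)
    (hME : ∀ α, ∑' β : {β | S β ⊆ S α}, (π β : ℝ≥0∞) ^ (1 - q) * μ (S (β : E)) ^ q ≤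
      M * μ (S α)) :
    ∫⁻ x, (∑ α ∈ F, (S α).indicator (fun _ => (φ α : ℝ≥0∞)) x) ^ p ∂μ ≤
      ENNReal.ofReal p ^ p * M ^ (p - 1) * ∑ α ∈ F, (φ α : ℝ≥0∞) ^ p * π α := by
  classical
  have hp := hpq.lt
  have hq := hpq.symm.lt
  set Δ : E → ℝ := fun α => sumUp S F φ α ^ p - sumAbove S F φ α ^ p with hΔ
  have hΔnn : ∀ α, 0 ≤ Δ α := fun α =>
    sub_nonneg.2 (Real.rpow_le_rpow (sumAbove_nonneg α) (sumAbove_le_sumUp α) hpq.nonneg)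
  set a : E → ℝ≥0∞ := fun α => (π α : ℝ≥0∞) ^ (1 - q) * μ (S α) ^ q with ha
  have hX : ∫⁻ x, (∑ α ∈ F, (S α).indicator (fun _ => (φ α : ℝ≥0∞)) x) ^ p ∂μ =
      ∑ α ∈ F, ENNReal.ofReal (Δ α) * μ (S α) := by
    have : ∀ x, (∑ α ∈ F, (S α).indicator (fun _ => (φ α : ℝ≥0∞)) x) ^ p =
        ∑ α ∈ F, (S α).indicator (fun _ => ENNReal.ofReal (Δ α)) x := by
      intro x
      have h := sum_telescope_at (F := F) (φ := φ) hinj hnest (fun s => s ^ p) x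
      simp only [Real.zero_rpow hpq.ne_zero, sub_zero] at h
      rw [sum_indicator_eq_ofReal, ENNReal.ofReal_rpow_of_nonneg (sumAt_nonneg x) hpq.nonneg, ← h,
        ENNReal.ofReal_sum_of_nonneg fun α _ => hΔnn α, Finset.sum_filter]
      simp [Set.indicator_apply, hΔ]
    simp_rw [this]
    rw [lintegral_finsetSum _ fun α _ => measurable_const.indicator (hmeas α)]
    simp [hmeas]
  have hXtop : ∑ α ∈ F, ENNReal.ofReal (Δ α) * μ (S α) ≠ ∞ :=
    (ENNReal.sum_lt_top.2 fun α _ =>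
      ENNReal.mul_lt_top ENNReal.ofReal_lt_top (measure_lt_top μ _)).ne
  have hafin : ∀ β, ∑ α ∈ F with S α ⊆ S β, a α ≤ M * μ (S β) := by
    intro β
    refine le_trans ?_ (hME β)
    rw [tsum_subtype {α | S α ⊆ S β} a]
    refine le_trans (le_of_eq ?_) (ENNReal.sum_le_tsum F)
    rw [Finset.sum_filter]
    simp [Set.indicator_apply]
  -- Here π^(1-q) = ∞, so positive mass would make the energy infinite; M and μ are finite.
  have hzero : ∀ α, π α = 0 → μ (S α) = 0 := by
    intro α hα
    by_contra hμ
    have h1 : a α ≤ M * μ (S α) := by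
      refine le_trans ?_ (hME α)
      exact ENNReal.le_tsum (f := fun β : {β | S β ⊆ S α} => a β) ⟨α, (subset_rfl : S α ⊆ S α)⟩
    have h2 : a α = ∞ := by
      simp only [ha, hα, ENNReal.coe_zero]
      rw [ENNReal.zero_rpow_of_neg (by linarith), ENNReal.top_mul]
      simp [ENNReal.rpow_eq_zero_iff, hμ]
    rw [h2, top_le_iff] at h1
    exact ENNReal.mul_ne_top hM (measure_ne_top μ _) h1
  have hterm : ∀ α ∈ F, ENNReal.ofReal (Δ α) * μ (S α) ≤ ENNReal.ofReal p *
      (((φ α : ℝ≥0∞) * (π α : ℝ≥0∞) ^ (1 / p)) *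
        (ENNReal.ofReal (sumUp S F φ α) ^ (p - 1) * a α ^ (1 / q))) := by
    intro α hα
    rcases eq_or_ne (π α) 0 with h0 | h0
    · simp [hzero α h0]
    have h1 : ENNReal.ofReal (Δ α) ≤
        ENNReal.ofReal p * (φ α * ENNReal.ofReal (sumUp S F φ α) ^ (p - 1)) := by
      rw [ENNReal.ofReal_rpow_of_nonneg (sumUp_nonneg α) (by linarith), ← ENNReal.ofReal_coe_nnreal,
        ← ENNReal.ofReal_mul (NNReal.coe_nonneg _), ← ENNReal.ofReal_mul hpq.nonneg]
      refine ENNReal.ofReal_le_ofReal ?_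
      have := rpow_sub_rpow_le hp (sumAbove_nonneg α)
        (sumAbove_le_sumUp (S := S) (F := F) (φ := φ) α)
      rwa [sumUp_eq hinj hα, add_sub_cancel_left, ← sumUp_eq hinj hα] at this
    have h2 : (π α : ℝ≥0∞) ^ (1 / p) * a α ^ (1 / q) = μ (S α) := by
      have hπ : (π α : ℝ≥0∞) ≠ 0 := by simpa using h0
      rw [ha, ENNReal.mul_rpow_of_nonneg _ _ (by have := hpq.symm.pos; positivity),
        ← ENNReal.rpow_mul, ← ENNReal.rpow_mul, ← mul_assoc,
        ← ENNReal.rpow_add _ _ hπ ENNReal.coe_ne_top, mul_one_div_cancel hpq.symm.ne_zero,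
        ENNReal.rpow_one]
      have : 1 / p + (1 - q) * (1 / q) = 0 := by
        have := hpq.mul_eq_add
        have := hpq.symm.pos
        have := hpq.pos
        field_simp
        linarith
      rw [this, ENNReal.rpow_zero, one_mul]
    calc _ ≤ ENNReal.ofReal p * (φ α * ENNReal.ofReal (sumUp S F φ α) ^ (p - 1)) * μ (S α) := by
          gcongr
      _ = _ := by
          rw [← h2]
          ring
  -- u(α)^p is expanded into the increments Δ over sets containing S α; exchanging sums leaves the
  -- energy below each β, which the hypothesis controls.
  have hsum : ∑ α ∈ F, ENNReal.ofReal (sumUp S F φ α) ^ p * a α ≤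
      M * ∑ α ∈ F, ENNReal.ofReal (Δ α) * μ (S α) := by
    calc ∑ α ∈ F, ENNReal.ofReal (sumUp S F φ α) ^ p * a α
        = ∑ α ∈ F, ∑ β ∈ F, if S α ⊆ S β then ENNReal.ofReal (Δ β) * a α else 0 := by
          refine Finset.sum_congr rfl fun α _ => ?_
          have h := sum_telescope_up (F := F) (φ := φ) hinj hnest hne (fun s => s ^ p) α
          simp only [Real.zero_rpow hpq.ne_zero, sub_zero] at h
          rw [ENNReal.ofReal_rpow_of_nonneg (sumUp_nonneg α) hpq.nonneg, ← h,
            ENNReal.ofReal_sum_of_nonneg fun α _ => hΔnn α, Finset.sum_mul, Finset.sum_filter]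
      _ = ∑ β ∈ F, ENNReal.ofReal (Δ β) * ∑ α ∈ F with S α ⊆ S β, a α := by
          rw [Finset.sum_comm]
          refine Finset.sum_congr rfl fun β _ => ?_
          rw [Finset.mul_sum, Finset.sum_filter]
      _ ≤ ∑ β ∈ F, ENNReal.ofReal (Δ β) * (M * μ (S β)) := by
          gcongr with β
          exact hafin β
      _ = _ := by
          rw [Finset.mul_sum]
          exact Finset.sum_congr rfl fun β _ => by ring
  rw [hX]
  refine le_of_le_mul_rpow hpq hXtop ?_
  calc ∑ α ∈ F, ENNReal.ofReal (Δ α) * μ (S α)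
      ≤ ENNReal.ofReal p * ∑ α ∈ F, (((φ α : ℝ≥0∞) * (π α : ℝ≥0∞) ^ (1 / p)) *
        (ENNReal.ofReal (sumUp S F φ α) ^ (p - 1) * a α ^ (1 / q))) := by
        rw [Finset.mul_sum]
        exact Finset.sum_le_sum hterm
    _ ≤ ENNReal.ofReal p * ((∑ α ∈ F, ((φ α : ℝ≥0∞) * (π α : ℝ≥0∞) ^ (1 / p)) ^ p) ^ (1 / p) *
        (∑ α ∈ F, (ENNReal.ofReal (sumUp S F φ α) ^ (p - 1) * a α ^ (1 / q)) ^ q) ^ (1 / q)) := by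
        gcongr
        exact ENNReal.inner_le_Lp_mul_Lq _ _ _ hpq
    _ = ENNReal.ofReal p * ((∑ α ∈ F, (φ α : ℝ≥0∞) ^ p * π α) ^ (1 / p) *
        (∑ α ∈ F, ENNReal.ofReal (sumUp S F φ α) ^ p * a α) ^ (1 / q)) := by
        congr 3
        · refine Finset.sum_congr rfl fun α _ => ?_
          rw [ENNReal.mul_rpow_of_nonneg _ _ hpq.nonneg, ← ENNReal.rpow_mul,
            one_div_mul_cancel hpq.ne_zero, ENNReal.rpow_one]
        · refine Finset.sum_congr rfl fun α _ => ?_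
          rw [ENNReal.mul_rpow_of_nonneg _ _ hpq.symm.nonneg, ← ENNReal.rpow_mul,
            ← ENNReal.rpow_mul, one_div_mul_cancel hpq.symm.ne_zero, ENNReal.rpow_one]
          congr 2
          linarith [hpq.mul_eq_add]
    _ ≤ _ := by
        have := hpq.symm.pos
        gcongr

/-- Testing the Hardy inequality with constant `C` on `π ^ (1 - q) * μ(S) ^ (q - 1)` below `S α`
gives the mass-energy condition with constant `C ^ (q - 1)`. -/
theorem sum_le_of_lintegral_le (hmeas : ∀ α, MeasurableSet (S α)) {p q : ℝ}
    (hpq : p.HolderConjugate q) (π : E → ℝ≥0) (μ : Measure X) [IsFiniteMeasure μ] (F : Finset E)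
    {C : ℝ≥0∞}
    (hH : ∀ (F : Finset E) (φ : E → ℝ≥0),
      ∫⁻ x, (∑ α ∈ F, (S α).indicator (fun _ => (φ α : ℝ≥0∞)) x) ^ p ∂μ ≤
        C * ∑ α ∈ F, (φ α : ℝ≥0∞) ^ p * π α)
    (α : E) (hF : ∀ β ∈ F, S β ⊆ S α) :
    ∑ β ∈ F, (π β : ℝ≥0∞) ^ (1 - q) * μ (S β) ^ q ≤ C ^ (q - 1) * μ (S α) := by
  classical
  have hp := hpq.lt
  have hq := hpq.symm.lt
  -- Testing on the single edge β gives μ(S β) ≤ C * 0 = 0, even for C = ∞.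
  have hzero : ∀ β, π β = 0 → μ (S β) = 0 := by
    intro β hβ
    have h := hH {β} 1
    simp only [Finset.sum_singleton, hβ, ENNReal.coe_zero, mul_zero, nonpos_iff_eq_zero] at h
    have h2 : ∀ x, (S β).indicator (fun _ => (((1 : E → ℝ≥0) β : ℝ≥0) : ℝ≥0∞)) x ^ p =
        (S β).indicator (fun _ => 1) x := by
      intro x
      by_cases hx : x ∈ S β <;> simp [hx, hpq.pos]
    simp_rw [h2] at h
    simpa [lintegral_indicator_const, hmeas] using h
  set ψ : E → ℝ≥0 := fun β => ((π β : ℝ≥0∞) ^ (1 - q) * μ (S β) ^ (q - 1)).toNNReal with hψ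
  have hψ' : ∀ β, (π β) ≠ 0 → (ψ β : ℝ≥0∞) = (π β : ℝ≥0∞) ^ (1 - q) * μ (S β) ^ (q - 1) := by
    intro β hβ
    refine ENNReal.coe_toNNReal (ENNReal.mul_ne_top ?_ ?_)
    · simp [ENNReal.rpow_eq_top_iff, hβ]
    · exact ENNReal.rpow_ne_top_of_nonneg (by linarith) (measure_ne_top μ _)
  have e1 : ∀ β, (ψ β : ℝ≥0∞) * μ (S β) = (π β : ℝ≥0∞) ^ (1 - q) * μ (S β) ^ q := by
    intro β
    rcases eq_or_ne (μ (S β)) 0 with h0 | h0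
    · simp [h0, hpq.symm.pos]
    rw [hψ' β (fun h => h0 (hzero β h)), mul_assoc]
    congr 1
    nth_rw 2 [← ENNReal.rpow_one (μ (S β))]
    rw [← ENNReal.rpow_add _ _ h0 (measure_ne_top μ _), sub_add_cancel]
  -- The choice of ψ makes its energy density equal to ψ μ(S), by p + q = pq; hence the same Q on
  -- both sides below.
  have e2 : ∀ β, (ψ β : ℝ≥0∞) ^ p * π β = (π β : ℝ≥0∞) ^ (1 - q) * μ (S β) ^ q := by
    intro β
    rcases eq_or_ne (μ (S β)) 0 with h0 | h0
    · have : ψ β = 0 := by simp [hψ, h0, (sub_pos.2 hq).ne']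
      simp [this, h0, hpq.symm.pos, hpq.pos]
    have hπ : π β ≠ 0 := fun h => h0 (hzero β h)
    have hπ' : (π β : ℝ≥0∞) ≠ 0 := by simpa using hπ
    rw [hψ' β hπ, ENNReal.mul_rpow_of_nonneg _ _ hpq.nonneg, ← ENNReal.rpow_mul,
      ← ENNReal.rpow_mul, mul_right_comm]
    nth_rw 2 [← ENNReal.rpow_one (π β : ℝ≥0∞)]
    rw [← ENNReal.rpow_add _ _ hπ' ENNReal.coe_ne_top]
    have := hpq.mul_eq_add
    congr 2 <;> linarith
  set Q := ∑ β ∈ F, (π β : ℝ≥0∞) ^ (1 - q) * μ (S β) ^ q with hQ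
  have hQtop : Q ≠ ∞ := by
    rw [hQ, ← Finset.sum_congr rfl fun β _ => e1 β]
    exact (ENNReal.sum_lt_top.2 fun β _ =>
      ENNReal.mul_lt_top ENNReal.coe_lt_top (measure_lt_top μ _)).ne
  set u : X → ℝ≥0∞ := fun x => ∑ β ∈ F, (S β).indicator (fun _ => (ψ β : ℝ≥0∞)) x with hu
  have hum : Measurable u :=
    Finset.measurable_sum _ fun β _ => measurable_const.indicator (hmeas β)
  have hQu : Q = ∫⁻ x, (u * ((S α).indicator 1 : X → ℝ≥0∞)) x ∂μ := by
    have : u * ((S α).indicator 1 : X → ℝ≥0∞) = u := by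
      ext x
      by_cases hx : x ∈ S α
      · simp [hx]
      · have : u x = 0 := Finset.sum_eq_zero fun β hβ => by
          rw [Set.indicator_of_notMem fun h => hx (hF β hβ h)]
        simp [this]
    rw [this, hu, lintegral_finsetSum _ fun β _ => measurable_const.indicator (hmeas β), hQ]
    refine Finset.sum_congr rfl fun β _ => ?_
    rw [lintegral_indicator_const (hmeas β), e1]
  have hind : ∫⁻ x, ((S α).indicator 1 x : ℝ≥0∞) ^ q ∂μ = μ (S α) := by
    have : ∀ x, ((S α).indicator 1 x : ℝ≥0∞) ^ q = (S α).indicator 1 x := by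
      intro x
      by_cases hx : x ∈ S α <;> simp [hx, hpq.symm.pos]
    simp_rw [this]
    exact lintegral_indicator_one (hmeas α)
  have hQle : Q ≤ (C * Q) ^ (1 / p) * μ (S α) ^ (1 / q) := by
    calc Q ≤ (∫⁻ x, u x ^ p ∂μ) ^ (1 / p) *
          (∫⁻ x, ((S α).indicator 1 x : ℝ≥0∞) ^ q ∂μ) ^ (1 / q) := by
          rw [hQu]
          exact ENNReal.lintegral_mul_le_Lp_mul_Lq μ hpq hum.aemeasurable
            (measurable_one.indicator (hmeas α)).aemeasurable
      _ ≤ _ := by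
          rw [hind]
          have := hpq.pos
          gcongr
          refine (hH F ψ).trans (le_of_eq ?_)
          rw [Finset.sum_congr rfl fun β _ => e2 β]
  -- The exponents p and q have exchanged roles, which yields C ^ (q - 1).
  have := le_of_le_mul_rpow hpq.symm (X := Q) (A := 1) (M := C) (e := μ (S α)) hQtop
    (by rw [one_mul, mul_comm]; exact hQle)
  simpa using this

end MassEnergy

/-! ### From finite sums to the optimal constants on the tree. -/

section Constants

open MeasureTheory

variable {V : Type*} {G : SimpleGraph V} {r : V}

theorem measurableSet_successorSet (α : G.edgeSet) : MeasurableSet (successorSet r α) :=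
  (TopologicalSpace.isOpen_generateFrom_of_mem (Or.inl ⟨α, rfl⟩)).measurableSet

theorem hardyOp_eq_tsum_indicator (φ : G.edgeSet → ℝ≥0) (x : ClosedTree G r) :
    hardyOp φ x = ∑' α, (successorSet r α).indicator (fun _ => (φ α : ℝ≥0∞)) x :=
  tsum_subtype x.edgesTo fun α => (φ α : ℝ≥0∞)

theorem sum_indicator_le_hardyOp (F : Finset G.edgeSet) (φ : G.edgeSet → ℝ≥0)
    (x : ClosedTree G r) :
    ∑ α ∈ F, (successorSet r α).indicator (fun _ => (φ α : ℝ≥0∞)) x ≤ hardyOp φ x := by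
  rw [hardyOp_eq_tsum_indicator]
  exact ENNReal.sum_le_tsum F

open Classical in
theorem sum_le_hardyOp_piecewise (F : Finset G.edgeSet) (φ : G.edgeSet → ℝ≥0)
    (x : ClosedTree G r) :
    ∑ α ∈ F, (successorSet r α).indicator (fun _ => (φ α : ℝ≥0∞)) x ≤
      hardyOp (fun α => if α ∈ F then φ α else 0) x := by
  refine le_trans (le_of_eq ?_) (sum_indicator_le_hardyOp F _ x)
  exact Finset.sum_congr rfl fun α hα => by simp [hα]

open Classical in
theorem edgeEnergy_piecewise {p : ℝ} (hp : 0 < p) (π : G.edgeSet → ℝ≥0) (F : Finset G.edgeSet)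
    (φ : G.edgeSet → ℝ≥0) :
    edgeEnergy p π (fun α => if α ∈ F then φ α else 0) =
      ∑ α ∈ F, (φ α : ℝ≥0∞) ^ p * π α := by
  rw [edgeEnergy, tsum_eq_sum (s := F) fun α hα => by simp [hα, hp]]
  exact Finset.sum_congr rfl fun α hα => by simp [hα]

theorem sum_energy_ne_top {p : ℝ} (hp : 0 < p) (π : G.edgeSet → ℝ≥0) (F : Finset G.edgeSet)
    (φ : G.edgeSet → ℝ≥0) : ∑ α ∈ F, (φ α : ℝ≥0∞) ^ p * π α ≠ ∞ :=
  (ENNReal.sum_lt_top.2 fun _ _ => ENNReal.mul_lt_top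
    (ENNReal.rpow_lt_top_of_nonneg hp.le ENNReal.coe_ne_top) ENNReal.coe_lt_top).ne

/-- It suffices to test the Hardy inequality on finitely supported functions. -/
theorem hardyInequality_iff_finset [Countable G.edgeSet] {p : ℝ} (hp : 0 < p)
    (π : G.edgeSet → ℝ≥0) (μ : Measure (ClosedTree G r)) (C : ℝ≥0∞) :
    HardyInequality p π μ C ↔ ∀ (F : Finset G.edgeSet) (φ : G.edgeSet → ℝ≥0),
      ∫⁻ x, (∑ α ∈ F, (successorSet r α).indicator (fun _ => (φ α : ℝ≥0∞)) x) ^ p ∂μ ≤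
        C * ∑ α ∈ F, (φ α : ℝ≥0∞) ^ p * π α := by
  classical
  constructor
  · intro h F φ
    rw [← edgeEnergy_piecewise hp]
    refine le_trans (lintegral_mono fun x => ?_) (h _)
    exact ENNReal.rpow_le_rpow (sum_le_hardyOp_piecewise F φ x) hp.le
  · intro h φ
    have e : ∀ x : ClosedTree G r, hardyOp φ x ^ p = ⨆ F : Finset G.edgeSet,
        (∑ α ∈ F, (successorSet r α).indicator (fun _ => (φ α : ℝ≥0∞)) x) ^ p := by
      intro x
      rw [hardyOp_eq_tsum_indicator, ENNReal.tsum_eq_iSup_sum]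
      exact (ENNReal.orderIsoRpow p hp).map_iSup _
    simp_rw [e]
    rw [lintegral_iSup_directed]
    · refine iSup_le fun F => (h F φ).trans ?_
      gcongr
      exact ENNReal.sum_le_tsum F
    · intro F
      exact ((Finset.measurable_sum _ fun α _ =>
        measurable_const.indicator (measurableSet_successorSet α)).pow_const p).aemeasurable
    · refine directed_of_isDirected_le fun F F' hFF x => ?_
      exact ENNReal.rpow_le_rpow (Finset.sum_le_sum_of_subset hFF) hp.le

/-- For finitely supported φ the energy is finite, so the inequality is a bound on a quotient and
passes to the infimum. This avoids the product 0 * ∞. -/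
theorem hardyInequality_traceNorm [Countable G.edgeSet] {p : ℝ} (hp : 0 < p)
    (π : G.edgeSet → ℝ≥0) (μ : Measure (ClosedTree G r)) (h : traceNorm p π μ ≠ ∞) :
    HardyInequality p π μ (traceNorm p π μ) := by
  rw [hardyInequality_iff_finset hp]
  intro F φ
  rw [← ENNReal.div_le_iff_le_mul (Or.inr h) (Or.inl (sum_energy_ne_top hp π F φ))]
  refine le_sInf fun C hC => ENNReal.div_le_of_le_mul ?_
  exact (hardyInequality_iff_finset hp π μ C).1 hC F φ

theorem isocapacitaryConst_le_traceNorm {p : ℝ} (hp : 0 < p) (π : G.edgeSet → ℝ≥0)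
    (μ : Measure (ClosedTree G r)) : isocapacitaryConst p π μ ≤ traceNorm p π μ := by
  refine le_sInf fun C hC => iSup_le fun n => iSup_le fun α => iSup_le fun hα => ?_
  -- Inversion turns the infimum into a supremum, so each admissible φ is treated separately: (Iφ)^p
  -- dominates the indicator of the union.
  rw [capacity, sInf_eq_iInf, ENNReal.inv_iInf, ENNReal.iSup_mul]
  refine iSup_le fun c => ?_
  rw [ENNReal.inv_iInf, ENNReal.iSup_mul]
  refine iSup_le ?_
  rintro ⟨φ, hφ, rfl⟩
  rw [mul_comm, ← div_eq_mul_inv]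
  refine ENNReal.div_le_of_le_mul (le_trans ?_ (hC φ))
  have hmeas := MeasurableSet.iUnion fun i => measurableSet_successorSet (r := r) (α i)
  rw [← tsum_fintype (L := .unconditional _), ← measure_iUnion hα fun i => measurableSet_successorSet (α i),
    ← lintegral_indicator_one hmeas]
  refine lintegral_mono fun x => ?_
  by_cases hx : x ∈ ⋃ i, successorSet r (α i)
  · simpa only [Set.indicator_of_mem hx, Pi.one_apply] using ENNReal.one_le_rpow (hφ x hx) hp
  · simp only [Set.indicator_of_notMem hx, zero_le]

theorem traceNorm_le_isocapacitaryConst [Countable G.edgeSet] (hG : G.IsTree) {p : ℝ} (hp : 1 < p)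
    (π : G.edgeSet → ℝ≥0) (μ : Measure (ClosedTree G r)) :
    traceNorm p π μ ≤ 2 ^ p * isocapacitaryConst p π μ := by
  classical
  have hp0 : 0 < p := by linarith
  rcases eq_or_ne (isocapacitaryConst p π μ) ∞ with htop | htop
  · rw [htop, ENNReal.mul_top (by simp [ENNReal.rpow_eq_zero_iff])]
    exact le_top
  refine sInf_le ((hardyInequality_iff_finset hp0 π μ _).2 fun F φ => ?_)
  refine lintegral_le_of_isocapacitary (successorSet_injective hG)
    (fun x α β => successorSet_nested hG) measurableSet_successorSet hp π μ F φ _ ?_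
  intro T ψ hT hψ
  rw [← ENNReal.div_le_iff_le_mul (Or.inr htop) (Or.inl (sum_energy_ne_top hp0 π F ψ)),
    div_eq_mul_inv, mul_comm]
  set e : Fin T.card → G.edgeSet := fun i => T.equivFin.symm i with he
  have hdisj : Pairwise fun i j => Disjoint (successorSet r (e i)) (successorSet r (e j)) :=
    fun i j hij => hT _ (T.equivFin.symm i).2 _ (T.equivFin.symm j).2 fun h =>
      hij (T.equivFin.symm.injective (Subtype.ext h))
  -- Cut off outside F, ψ is still admissible, so its finite energy bounds the capacity.
  have hcap : capacity p π (⋃ i, successorSet r (e i)) ≤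
      ∑ α ∈ F, (ψ α : ℝ≥0∞) ^ p * π α := by
    refine sInf_le ⟨fun α => if α ∈ F then ψ α else 0, fun x hx => ?_,
      (edgeEnergy_piecewise hp0 π F ψ).symm⟩
    obtain ⟨i, hi⟩ := Set.mem_iUnion.1 hx
    exact (hψ _ (T.equivFin.symm i).2 x hi).trans (sum_le_hardyOp_piecewise F ψ x)
  have hsum : ∑ α ∈ T, μ (successorSet r α) = ∑ i, μ (successorSet r (e i)) := by
    rw [← Finset.sum_coe_sort T]
    exact (Equiv.sum_comp T.equivFin.symm fun α : T => μ (successorSet r (α : G.edgeSet))).symm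
  rw [hsum]
  refine le_trans ?_ (le_iSup_of_le T.card (le_iSup_of_le e (le_iSup_of_le hdisj le_rfl)))
  gcongr

theorem one_div_conj_sub_one {p q : ℝ} (hpq : p.HolderConjugate q) : 1 / (q - 1) = p - 1 := by
  have h1 := sub_pos.2 hpq.symm.lt
  have := hpq.mul_eq_add
  field_simp
  linarith

theorem massEnergyConst_le_traceNorm [Countable G.edgeSet] (hG : G.IsTree) {p : ℝ} (hp : 1 < p)
    (π : G.edgeSet → ℝ≥0) (μ : Measure (ClosedTree G r)) [IsFiniteMeasure μ] :
    massEnergyConst p π μ ≤ traceNorm p π μ := by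
  classical
  have hpq := Real.HolderConjugate.conjExponent hp
  have hq := sub_pos.2 hpq.symm.lt
  refine le_sInf fun C hC => ?_
  suffices massEnergyRatio p π μ ≤ C ^ (p.conjExponent - 1) by
    rw [massEnergyConst, one_div, ENNReal.rpow_inv_le_iff hq]
    exact this
  refine iSup_le fun α => ?_
  rw [mul_comm, ← div_eq_mul_inv]
  refine ENNReal.div_le_of_le_mul ?_
  rw [ENNReal.tsum_eq_iSup_sum]
  refine iSup_le fun T => ?_
  have := sum_le_of_lintegral_le measurableSet_successorSet hpq π μ
    (T.map (Function.Embedding.subtype _))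
    ((hardyInequality_iff_finset hpq.pos π μ C).1 hC) α fun β hβ => by
      obtain ⟨β, -, rfl⟩ := Finset.mem_map.1 hβ
      exact (edgesBelow_eq hG α).subset β.2
  rwa [Finset.sum_map] at this

theorem traceNorm_le_massEnergyConst [Countable G.edgeSet] (hG : G.IsTree) {p : ℝ} (hp : 1 < p)
    (π : G.edgeSet → ℝ≥0) (μ : Measure (ClosedTree G r)) [IsFiniteMeasure μ] :
    traceNorm p π μ ≤ ENNReal.ofReal p ^ p * massEnergyConst p π μ := by
  have hpq := Real.HolderConjugate.conjExponent hp
  rw [massEnergyConst, one_div_conj_sub_one hpq]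
  rcases eq_or_ne (massEnergyRatio p π μ) ∞ with htop | htop
  · rw [htop, ENNReal.top_rpow_of_pos (sub_pos.2 hp), ENNReal.mul_top]
    · exact le_top
    · simp [ENNReal.rpow_eq_zero_iff, hpq.pos, hpq.nonneg.not_gt]
  refine sInf_le ((hardyInequality_iff_finset hpq.pos π μ _).2 fun F φ => ?_)
  refine lintegral_le_of_massEnergy (successorSet_injective hG)
    (fun x α β => successorSet_nested hG) (successorSet_nonempty hG) measurableSet_successorSet
    hpq π μ F φ htop fun α => ?_
  rw [← ENNReal.div_le_iff_le_mul (Or.inr htop) (Or.inl (measure_ne_top μ _)), div_eq_mul_inv,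
    mul_comm, ← edgesBelow_eq hG]
  exact le_iSup (fun α : G.edgeSet => (μ (successorSet r α))⁻¹ * ∑' β : edgesBelow r α,
    (π β : ℝ≥0∞) ^ (1 - p.conjExponent) *
      μ (successorSet r (β : G.edgeSet)) ^ p.conjExponent) α

end Constants

end TreeHardy

theorem theorem1p2 {V : Type*} (G : SimpleGraph V) (hG : G.IsTree)
    (hfin : ∀ v, (G.neighborSet v).Finite)
    -- the pre-root `r` is adjacent to the root `o` and to no other vertex
    (r o : V) (hr : ∀ v, G.Adj r v ↔ v = o)
    (p : ℝ) (hp : 1 < p) (π : G.edgeSet → ℝ≥0)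
    (μ : MeasureTheory.Measure (TreeHardy.ClosedTree G r)) [MeasureTheory.IsFiniteMeasure μ] :
    List.TFAE [
      TreeHardy.HardyInequality p π μ (TreeHardy.traceNorm p π μ) ∧
        TreeHardy.traceNorm p π μ < ∞,
      TreeHardy.massEnergyRatio p π μ < ∞,
      TreeHardy.isocapacitaryConst p π μ < ∞] ∧
    TreeHardy.isocapacitaryConst p π μ ≤ TreeHardy.traceNorm p π μ ∧
    TreeHardy.traceNorm p π μ ≤ (2 : ℝ≥0∞) ^ p * TreeHardy.isocapacitaryConst p π μ ∧
    TreeHardy.massEnergyConst p π μ ≤ TreeHardy.traceNorm p π μ ∧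
    TreeHardy.traceNorm p π μ ≤ ENNReal.ofReal p ^ p * TreeHardy.massEnergyConst p π μ := by
  have hp0 : 0 < p := by linarith
  have : Countable V := TreeHardy.countable_of_locallyFinite hG.connected hfin r
  have : Countable (Sym2 V) := Quot.mk_surjective.countable
  have : Countable G.edgeSet := inferInstance
  have hpq := Real.HolderConjugate.conjExponent hp
  have iso_le := TreeHardy.isocapacitaryConst_le_traceNorm hp0 π μ
  have le_iso := TreeHardy.traceNorm_le_isocapacitaryConst hG hp π μ
  have energy_le := TreeHardy.massEnergyConst_le_traceNorm hG hp π μ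
  have le_energy := TreeHardy.traceNorm_le_massEnergyConst hG hp π μ
  -- The two differ by the positive power 1/(p* - 1).
  have const_lt : TreeHardy.massEnergyConst p π μ < ∞ ↔ TreeHardy.massEnergyRatio p π μ < ∞ :=
    ENNReal.rpow_lt_top_iff_of_pos (one_div_pos.2 (sub_pos.2 hpq.symm.lt))
  refine ⟨?_, iso_le, le_iso, energy_le, le_energy⟩
  tfae_have 1 → 2 := fun h => const_lt.1 (energy_le.trans_lt h.2)
  tfae_have 1 → 3 := fun h => iso_le.trans_lt h.2
  tfae_have 2 → 1 := fun h => by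
    have hlt := le_energy.trans_lt (ENNReal.mul_lt_top
      (ENNReal.rpow_lt_top_of_nonneg hp0.le ENNReal.ofReal_ne_top) (const_lt.2 h))
    exact ⟨TreeHardy.hardyInequality_traceNorm hp0 π μ hlt.ne, hlt⟩
  tfae_have 3 → 1 := fun h => by
    have hlt := le_iso.trans_lt (ENNReal.mul_lt_top
      (ENNReal.rpow_lt_top_of_nonneg hp0.le ENNReal.ofNat_ne_top) h)
    exact ⟨TreeHardy.hardyInequality_traceNorm hp0 π μ hlt.ne, hlt⟩
  tfae_finish
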